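/- All monoids are cancellative and commutative, written multiplicatively. For a commutative monoid $H$ with quotient group $\mathsf q(H)$ and $X,Y\subset \mathsf q(H)$ put $(Y:X)=\{a\in\mathsf q(H)\mid aX\subset Y\}$, $X^{-1}=(H:X)$, $X_v=(X^{-1})^{-1}$. A fractional ideal of $H$ is a subset $\mathfrak a\subset\mathsf q(H)$ with $H\mathfrak a\subset\mathfrak a$ and $d\mathfrak a\subset H$ for some $d\in H$; it is divisorial if $\mathfrak a=\mathfrak a_v$, and it is an ideal if $\mathfrak a\subset H$. $H$ is a Krull monoid if it satisfies the ascending chain condition on divisorial ideals and is completely integrally closed (if $x\in\mathsf q(H)$ and there is $c\in H$ with $cx^n\in H$ for all $n\ge 1$, then $x\in H$). $H$ is reduced if $1$ is its only unit. For a Krull monoid $H$ and $\tau\in\operatorname{Aut}(H)$ (extended to $\mathsf q(H)$), $H$ is $\tau$-$v$-simple if $\tau(\mathfrak a)\neq\mathfrak a$ for every nonempty divisorial fractional ideal $\mathfrak a\neq H$ of $H$. A commutative domain $D$ is a Krull domain if $D^\bullet=D\setminus\{0\}$ is a Krull monoid; for a Krull domain $D$ and $\sigma\in\operatorname{Aut}(D)$,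 $D$ is $\sigma$-$v$-simple if $D^\bullet$ is $\sigma|_{D^\bullet}$-$v$-simple. **Theorem.** Let $D$ be a commutative Krull domain and let $\sigma\in\operatorname{Aut}(D)$ be such that $D$ is $\sigma$-$v$-simple. Let $H$ be a reduced commutative Krull monoid and let $\tau\in\operatorname{Aut}(H)$ be such that $H$ is $\tau$-$v$-simple. Let $\varphi\in\operatorname{Aut}(D[H])$ be the extension of $\sigma$ and $\tau$ to the semigroup algebra $D[H]$, i.e. $\varphi|_D=\sigma$ and $\varphi|_H=\tau$. Then $D[H]$ is a Krull domain and it is $\varphi$-$v$-simple. -/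

import Mathlib

open scoped nonZeroDivisors

namespace KrullVSimple

open Algebra

noncomputable section

section Monoid

variable {H : Type*} [CommMonoid H]

/-- `H` as a subset of its quotient group `q(H)`. -/
def base (H : Type*) [CommMonoid H] : Set (GrothendieckGroup H) :=
  Set.range (GrothendieckGroup.of : H →* GrothendieckGroup H)

/-- `(Y : X) = {a ∈ q(H) | a X ⊆ Y}`. -/
def colon (Y X : Set (GrothendieckGroup H)) : Set (GrothendieckGroup H) :=
  {a | ∀ x ∈ X, a * x ∈ Y}

/-- `X⁻¹ = (H : X)`. -/
def colonInv (X : Set (GrothendieckGroup H)) : Set (GrothendieckGroup H) :=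
  colon (base H) X

/-- `X_v = (X⁻¹)⁻¹`. -/
def vClosure (X : Set (GrothendieckGroup H)) : Set (GrothendieckGroup H) :=
  colonInv (colonInv X)

/-- Fractional ideals of a commutative monoid: `H 𝔞 ⊆ 𝔞` and `d 𝔞 ⊆ H` for some `d ∈ H`. -/
def IsFractionalIdeal (𝔞 : Set (GrothendieckGroup H)) : Prop :=
  (∀ h : H, ∀ a ∈ 𝔞, GrothendieckGroup.of h * a ∈ 𝔞) ∧
    ∃ d : H, ∀ a ∈ 𝔞, GrothendieckGroup.of d * a ∈ base H

/-- Divisorial fractional ideals: `𝔞 = 𝔞_v`. -/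
def IsDivisorial (𝔞 : Set (GrothendieckGroup H)) : Prop :=
  IsFractionalIdeal 𝔞 ∧ vClosure 𝔞 = 𝔞

/-- Divisorial (integral) ideals: divisorial fractional ideals contained in `H`. -/
def IsDivisorialIdeal (𝔞 : Set (GrothendieckGroup H)) : Prop :=
  IsDivisorial 𝔞 ∧ 𝔞 ⊆ base H

/-- A commutative Krull monoid: cancellative, satisfying the ascending chain condition on
divisorial ideals, and completely integrally closed. -/
structure IsKrullMonoid (H : Type*) [CommMonoid H] : Prop where
  cancel : IsCancelMul H
  vNoetherian : ∀ 𝔞 : ℕ → Set (GrothendieckGroup H), (∀ n, IsDivisorialIdeal (𝔞 n)) →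
    Monotone 𝔞 → ∃ n, ∀ m, n ≤ m → 𝔞 m = 𝔞 n
  completelyIntegrallyClosed : ∀ x : GrothendieckGroup H,
    (∃ c : H, ∀ n : ℕ, 1 ≤ n → GrothendieckGroup.of c * x ^ n ∈ base H) → x ∈ base H

/-- A monoid is reduced if `1` is its only unit. -/
def IsReducedMonoid (H : Type*) [CommMonoid H] : Prop :=
  ∀ a : H, IsUnit a → a = 1

/-- The extension of an automorphism of `H` to the quotient group `q(H)`. -/
def extendQuo (τ : H ≃* H) : GrothendieckGroup H →* GrothendieckGroup H :=
  GrothendieckGroup.lift (GrothendieckGroup.of.comp τ.toMonoidHom)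

/-- `H` is `τ`-`v`-simple: no nonempty divisorial fractional ideal other than `H` is
mapped onto itself by `τ`. -/
def IsVSimple (τ : H ≃* H) : Prop :=
  ∀ 𝔞 : Set (GrothendieckGroup H), IsDivisorial 𝔞 → 𝔞.Nonempty → 𝔞 ≠ base H →
    extendQuo τ '' 𝔞 ≠ 𝔞

end Monoid

section Domain

/-- A commutative Krull domain: a domain `D` whose monoid of nonzero elements is a Krull monoid
(in a domain, `D⁰` is the monoid of nonzero elements). -/
structure IsKrullDomain (D : Type*) [CommRing D] : Prop where
  isDomain : IsDomain D
  isKrullMonoid : IsKrullMonoid D⁰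

variable {D : Type*} [CommRing D]

/-- The restriction of a ring automorphism of `D` to `D⁰`. -/
def restrictNonZero (σ : D ≃+* D) : D⁰ ≃* D⁰ :=
  (σ.toMulEquiv.submonoidMap D⁰).trans
    (MulEquiv.submonoidCongr (MulEquivClass.map_nonZeroDivisors σ))

/-- `D` is `σ`-`v`-simple: the monoid of nonzero elements of `D` is `v`-simple with respect to
the restriction of `σ`. -/
def IsVSimpleRing (σ : D ≃+* D) : Prop :=
  IsVSimple (restrictNonZero σ)

end Domain

end

end KrullVSimple

-- A cancellative monoid is Krull as soon as it has a divisor map, that is, a homomorphism into a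
-- free monoid ℕ^(I) turning divisibility into the componentwise order
-- (`IsDivisorMap.isKrullMonoid`). If an automorphism is compatible with a permutation of I without
-- finite orbits, the monoid is v-simple for it: the minimal exponents of an invariant nonempty
-- divisorial ideal form a finitely supported function that is constant on infinite orbits, hence
-- zero (`IsDivisorMap.isVSimple`). Conversely, the nonempty divisorial ideals of a Krull monoid
-- form a free monoid whose primes give a divisor map, and v-simplicity makes every orbit of primes
-- infinite, because the product over a finite orbit would be invariant
-- (`IsKrullMonoid.exists_isDivisorMap`).
--
-- It remains to find a divisor map on D[H]. As H is reduced, its divisor map is injective and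
-- embeds D[H] in a polynomial ring D[X_J]; quotients taken there of elements of D[H] stay in D[H]
-- (`IsDivisorMap.toMvPolynomial_dvd_iff`). On D[X_J], Gauss's lemma yields a divisor map from the
-- content with respect to the valuations of D together with the prime factorization over the
-- fraction field K (`IsValuativeDivisorMap.isRingDivisorMap_polyDivisor`).
--
-- The automorphism φ extends to D[X_J], acting by σ on coefficients and permuting variables.
-- Content components are permuted like the primes of D. A prime over K fixed up to units by a
-- positive power would have a finite set of monomials stable under a permutation whose only
-- periodic monomial is 1, so it would be constant (`primePerm_polyAut_pow_ne`).

universe u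

namespace KrullVSimple

open Algebra

/-! ### Divisor maps: criteria for being Krull and for v-simplicity -/

section DivisorMap

variable {H : Type*} [CommMonoid H] {I : Type*}

/-- A map to a free commutative monoid that is multiplicative and reflects divisibility. -/
structure IsDivisorMap (δ : H → I →₀ ℕ) : Prop where
  map_mul : ∀ a b, δ (a * b) = δ a + δ b
  dvd_iff : ∀ a b, a ∣ b ↔ δ a ≤ δ b

/-- A map from the quotient group to a free abelian group with `H` as its nonnegative part. -/
structure IsDefiningMap (w : GrothendieckGroup H → I →₀ ℤ) : Prop where
  map_mul : ∀ x y, w (x * y) = w x + w y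
  mem_base : ∀ x, x ∈ base H ↔ ∀ i, 0 ≤ w x i

lemma exists_eq_of_div_of (x : GrothendieckGroup H) :
    ∃ a b : H, x = GrothendieckGroup.of a / GrothendieckGroup.of b := by
  obtain ⟨⟨a, b⟩, h⟩ := (Localization.monoidOf (⊤ : Submonoid H)).surj x
  exact ⟨a, b, eq_div_of_mul_eq' h⟩

lemma of_dvd_iff [IsCancelMul H] {a b : H} :
    GrothendieckGroup.of b / GrothendieckGroup.of a ∈ base H ↔ a ∣ b := by
  constructor
  · rintro ⟨c, hc⟩
    refine ⟨c, GrothendieckGroup.of_injective ?_⟩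
    rw [map_mul, hc, mul_div_cancel]
  · rintro ⟨c, rfl⟩
    exact ⟨c, by rw [map_mul, mul_div_cancel_left]⟩

lemma of_mem_base (a : H) : GrothendieckGroup.of a ∈ base H := ⟨a, rfl⟩

lemma one_mem_base : (1 : GrothendieckGroup H) ∈ base H := ⟨1, map_one _⟩

lemma mul_mem_base {x y : GrothendieckGroup H} (hx : x ∈ base H) (hy : y ∈ base H) :
    x * y ∈ base H := by
  obtain ⟨a, rfl⟩ := hx
  obtain ⟨b, rfl⟩ := hy
  exact ⟨a * b, map_mul _ _ _⟩

lemma IsDivisorMap.exists_extension [IsCancelMul H] {δ : H → I →₀ ℕ} (h : IsDivisorMap δ) :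
    ∃ w : GrothendieckGroup H → I →₀ ℤ, IsDefiningMap w ∧
      ∀ a i, w (GrothendieckGroup.of a) i = δ a i := by
  have h1 : δ 1 = 0 := by simpa using h.map_mul 1 1
  let f : H →* Multiplicative (I →₀ ℤ) :=
    { toFun := fun a => Multiplicative.ofAdd ((δ a).mapRange (fun n : ℕ => (n : ℤ)) rfl)
      map_one' := by rw [h1]; simp
      map_mul' := fun a b => by
        rw [h.map_mul, ← ofAdd_add]
        congr 1
        ext i
        simp }
  let w : GrothendieckGroup H → I →₀ ℤ := fun x => (GrothendieckGroup.lift f x).toAdd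
  have hmul : ∀ x y, w (x * y) = w x + w y := fun x y => by simp [w]
  have hof : ∀ a i, w (GrothendieckGroup.of a) i = δ a i := fun a i => by
    have : GrothendieckGroup.lift f (GrothendieckGroup.of a) = f a :=
      DFunLike.congr_fun (GrothendieckGroup.lift.symm_apply_apply f) a
    simp only [w]
    rw [this]
    simp [f]
  refine ⟨w, ⟨hmul, fun x => ?_⟩, hof⟩
  obtain ⟨a, b, rfl⟩ := exists_eq_of_div_of x
  rw [of_dvd_iff, h.dvd_iff, Finsupp.le_def]
  refine forall_congr' fun i => ?_
  have := DFunLike.congr_fun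
    (hmul (GrothendieckGroup.of a / GrothendieckGroup.of b) (GrothendieckGroup.of b)) i
  rw [div_mul_cancel, Finsupp.add_apply, hof, hof] at this
  omega

namespace IsDefiningMap

variable {w : GrothendieckGroup H → I →₀ ℤ}

lemma map_pow (hw : IsDefiningMap w) (x : GrothendieckGroup H) (n : ℕ) (i : I) :
    w (x ^ n) i = n * w x i := by
  induction n with
  | zero =>
    have : w 1 = 0 := by simpa using hw.map_mul 1 1
    simp [this]
  | succ n ih =>
    rw [pow_succ, hw.map_mul, Finsupp.add_apply, ih]
    push_cast
    ring

lemma exists_isLeast (hw : IsDefiningMap w) {X : Set (GrothendieckGroup H)} (hne : X.Nonempty)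
    (d : GrothendieckGroup H) (hd : ∀ a ∈ X, d * a ∈ base H) :
    ∃ n : I →₀ ℤ, ∀ i, IsLeast ((fun x => w x i) '' X) (n i) := by
  obtain ⟨a, ha⟩ := hne
  have hlow : ∀ x ∈ X, ∀ i, - w d i ≤ w x i := fun x hx i => by
    have := (hw.mem_base _).1 (hd x hx) i
    rw [hw.map_mul, Finsupp.add_apply] at this
    omega
  have key : ∀ i, ∃ k, IsLeast ((fun x => w x i) '' X) k := fun i => by
    obtain ⟨k, hk, hk'⟩ := Int.exists_least_of_bdd (P := fun z => z ∈ (fun x => w x i) '' X)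
      ⟨- w d i, by rintro _ ⟨x, hx, rfl⟩; exact hlow x hx i⟩ ⟨_, a, ha, rfl⟩
    exact ⟨k, hk, hk'⟩
  choose n hn using key
  -- Each minimum lies between `- w d i` and `w a i`, so it vanishes outside two finite supports.
  refine ⟨Finsupp.ofSupportFinite n
    (((w a).support.finite_toSet.union (w d).support.finite_toSet).subset fun i hi => ?_), hn⟩
  have h1 : n i ≤ w a i := (hn i).2 ⟨a, ha, rfl⟩
  obtain ⟨x, hx, hxi⟩ := (hn i).1
  have h2 := hlow x hx i
  simp only [Function.mem_support] at hi
  simp only [Set.mem_union, Finset.mem_coe, Finsupp.mem_support_iff]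
  simp only at hxi
  omega

lemma mem_colonInv (hw : IsDefiningMap w) {X : Set (GrothendieckGroup H)} {n : I →₀ ℤ}
    (hn : ∀ i, IsLeast ((fun x => w x i) '' X) (n i)) (x : GrothendieckGroup H) :
    x ∈ colonInv X ↔ ∀ i, 0 ≤ w x i + n i := by
  constructor
  · intro hx i
    obtain ⟨y, hy, hyi⟩ := (hn i).1
    have := (hw.mem_base _).1 (hx y hy) i
    rw [hw.map_mul, Finsupp.add_apply] at this
    simp only at hyi
    omega
  · intro h y hy
    rw [hw.mem_base]
    intro i
    have h1 := h i
    have h2 : n i ≤ w y i := (hn i).2 ⟨y, hy, rfl⟩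
    rw [hw.map_mul, Finsupp.add_apply]
    omega

end IsDefiningMap

lemma colonInv_anti {X Y : Set (GrothendieckGroup H)} (h : X ⊆ Y) : colonInv Y ⊆ colonInv X :=
  fun _ ha x hx => ha x (h hx)

/-- A divisorial ideal is determined by the minimal exponents of its inverse. Along an ascending
chain these increase within a finite interval, so they stabilize. -/
lemma IsDivisorMap.isKrullMonoid [IsCancelMul H] {δ : H → I →₀ ℕ} (h : IsDivisorMap δ) :
    IsKrullMonoid H := by
  obtain ⟨w, hw, hof⟩ := h.exists_extension
  refine ⟨inferInstance, fun A hA hmono => ?_, fun x ⟨c, hc⟩ => ?_⟩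
  · classical
    by_cases hemp : ∀ m, A m = ∅
    · exact ⟨0, fun m _ => by rw [hemp, hemp]⟩
    push Not at hemp
    obtain ⟨N, a, ha⟩ := hemp
    have ha' : ∀ k, a ∈ A (N + k) := fun k => hmono (Nat.le_add_right _ _) ha
    have hone : ∀ k, (1 : GrothendieckGroup H) ∈ colonInv (A k) := fun k x hx => by
      rw [one_mul]; exact (hA k).2 hx
    have hleast : ∀ k, ∃ n : I →₀ ℤ, ∀ i,
        IsLeast ((fun x => w x i) '' colonInv (A (N + k))) (n i) := fun k =>
      hw.exists_isLeast ⟨1, hone _⟩ a fun y hy => by rw [mul_comm]; exact hy a (ha' k)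
    choose n hn using hleast
    -- The lower bound comes from `a` lying in the double inverse, the upper one from `1` lying in
    -- the inverse.
    have hmem : ∀ k, n k ∈ Set.Icc (- w a) 0 := fun k => by
      constructor
      · intro i
        have := (hw.mem_colonInv (hn k) a).1 (by
          have : vClosure (A (N + k)) = A (N + k) := (hA _).1.2
          rw [← vClosure, this]
          exact ha' k) i
        simp only [Finsupp.coe_neg, Pi.neg_apply]
        omega
      · intro i
        have h1 : w 1 = 0 := by simpa using hw.map_mul 1 1
        have := (hn k i).2 ⟨1, hone _, rfl⟩
        simpa [h1] using this
    have hnmono : Monotone n := fun k l hkl i => by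
      obtain ⟨y, hy, hyi⟩ := (hn l i).1
      rw [← hyi]
      exact (hn k i).2 ⟨y, colonInv_anti (hmono (by omega)) hy, rfl⟩
    have hfin : (Set.range n).Finite :=
      (Set.finite_Icc (- w a) 0).subset (by rintro _ ⟨k, rfl⟩; exact hmem k)
    obtain ⟨_, ⟨K, rfl⟩, hK⟩ := hfin.exists_maximal (Set.range_nonempty n)
    refine ⟨N + K, fun m hm => ?_⟩
    obtain ⟨l, rfl⟩ : ∃ l, m = N + l := ⟨m - N, by omega⟩
    have hlK : n l = n K :=
      le_antisymm (hK ⟨l, rfl⟩ (hnmono (by omega))) (hnmono (by omega))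
    rw [← (hA (N + l)).1.2, ← (hA (N + K)).1.2]
    ext x
    rw [vClosure, vClosure, hw.mem_colonInv (hn l), hw.mem_colonInv (hn K), hlK]
  · rw [hw.mem_base]
    intro i
    by_contra hneg
    push Not at hneg
    -- As `w x i ≤ -1`, this exponent already outweighs the contribution of `c`.
    have := (hw.mem_base _).1 (hc (δ c i + 1) (by omega)) i
    rw [hw.map_mul, Finsupp.add_apply, hw.map_pow, hof] at this
    push_cast at this
    nlinarith

lemma extendQuo_of (τ : H ≃* H) (a : H) :
    extendQuo τ (GrothendieckGroup.of a) = GrothendieckGroup.of (τ a) :=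
  DFunLike.congr_fun (GrothendieckGroup.lift.symm_apply_apply
    (GrothendieckGroup.of.comp τ.toMonoidHom)) a

lemma IsDivisorMap.isVSimple [IsCancelMul H] {δ : H → I →₀ ℕ} (h : IsDivisorMap δ) (τ : H ≃* H)
    (π : Equiv.Perm I) (hπ : ∀ a i, δ (τ a) (π i) = δ a i)
    (hinf : ∀ i n, 0 < n → (π ^ n) i ≠ i) : IsVSimple τ := by
  intro A hA hne hbase hinv
  apply hbase
  obtain ⟨w, hw, hof⟩ := h.exists_extension
  obtain ⟨d, hd⟩ := hA.1.2
  obtain ⟨n, hn⟩ := hw.exists_isLeast hne _ hd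
  have hwτ : ∀ x i, w (extendQuo τ x) (π i) = w x i := fun x i => by
    obtain ⟨a, b, rfl⟩ := exists_eq_of_div_of x
    have h1 := DFunLike.congr_fun
      (hw.map_mul (GrothendieckGroup.of a / GrothendieckGroup.of b) (GrothendieckGroup.of b)) i
    have h2 := DFunLike.congr_fun (hw.map_mul
      (extendQuo τ (GrothendieckGroup.of a / GrothendieckGroup.of b))
      (extendQuo τ (GrothendieckGroup.of b))) (π i)
    rw [← _root_.map_mul, div_mul_cancel, Finsupp.add_apply, extendQuo_of, extendQuo_of, hof, hof, hπ,
      hπ] at h2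
    rw [div_mul_cancel, Finsupp.add_apply, hof, hof] at h1
    omega
  -- Both sides are the least exponent of the same set, by invariance of `A`.
  have hnπ : ∀ i, n (π i) = n i := fun i => by
    refine (hn (π i)).unique ?_
    have := hn i
    rw [← hinv, Set.image_image]
    simpa only [hwτ] using this
  have hpow : ∀ (k : ℕ) i, n ((π ^ k) i) = n i := fun k i => by
    induction k with
    | zero => rfl
    | succ k ih => rw [pow_succ', Equiv.Perm.mul_apply, hnπ, ih]
  have hn0 : ∀ i, n i = 0 := fun i => by
    by_contra hi
    have hinj : Function.Injective fun k : ℕ => (π ^ k) i := by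
      refine Function.Injective.of_lt_imp_ne fun k l hkl heq => ?_
      refine hinf i (l - k) (by omega) ((π ^ k).injective ?_)
      rw [← Equiv.Perm.mul_apply, ← pow_add, Nat.add_sub_cancel' hkl.le]
      exact heq.symm
    refine Set.infinite_range_of_injective hinj (n.support.finite_toSet.subset ?_)
    rintro _ ⟨k, rfl⟩
    simpa [hpow] using hi
  have hinvbase : colonInv A = base H := by
    ext x
    rw [hw.mem_colonInv hn, hw.mem_base]
    simp [hn0]
  rw [← hA.2, vClosure, hinvbase]
  ext x
  constructor
  · intro hx
    simpa using hx 1 one_mem_base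
  · intro hx y hy
    exact mul_mem_base hx hy

end DivisorMap

/-! ### Prime factorizations and automorphisms in factorial monoids -/

section PrimeExponents

open UniqueFactorizationMonoid

variable {N : Type*} [CommMonoidWithZero N] [UniqueFactorizationMonoid N] [Subsingleton Nˣ]

open Classical in
/-- The exponents in the prime factorization of an element of a factorial monoid whose only unit
is `1`. -/
noncomputable def primeExponents (a : N) : {p : N // Prime p} →₀ ℕ :=
  (Multiset.toFinsupp (normalizedFactors a)).subtypeDomain Prime

/-- Expressing exponents by divisibility alone makes their behaviour under automorphisms immediate.
-/
lemma le_primeExponents_iff {a : N} (ha : a ≠ 0) (p : {p : N // Prime p}) (n : ℕ) :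
    n ≤ primeExponents a p ↔ p.1 ^ n ∣ a := by
  classical
  rw [primeExponents, Finsupp.subtypeDomain_apply, Multiset.toFinsupp_apply,
    pow_dvd_iff_le_emultiplicity,
    le_emultiplicity_iff_replicate_le_normalizedFactors p.2.irreducible ha, normalize_eq]
  convert Multiset.le_count_iff_replicate_le

lemma primeExponents_mul {a b : N} (ha : a ≠ 0) (hb : b ≠ 0) :
    primeExponents (a * b) = primeExponents a + primeExponents b := by
  rw [primeExponents, normalizedFactors_mul ha hb, map_add, Finsupp.subtypeDomain_add]
  rfl

lemma dvd_iff_primeExponents_le {a b : N} (ha : a ≠ 0) (hb : b ≠ 0) :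
    a ∣ b ↔ primeExponents a ≤ primeExponents b := by
  classical
  refine ⟨fun h p => ?_, fun h => ?_⟩
  · rw [le_primeExponents_iff hb]
    exact ((le_primeExponents_iff ha p _).1 le_rfl).trans h
  · rw [dvd_iff_normalizedFactors_le_normalizedFactors ha hb, Multiset.le_iff_count]
    intro p
    by_cases hp : Prime p
    · have := h ⟨p, hp⟩
      simp only [primeExponents, Finsupp.subtypeDomain_apply, Multiset.toFinsupp_apply] at this
      convert this
    · rw [Multiset.count_eq_zero_of_notMem fun hmem => hp (prime_of_normalized_factor _ hmem)]
      exact Nat.zero_le _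

/-- The permutation of the primes induced by an automorphism. -/
def primePerm {N : Type*} [CommMonoidWithZero N] (e : N ≃* N) : Equiv.Perm {p : N // Prime p} :=
  e.toEquiv.subtypeEquiv fun p => (MulEquiv.prime_iff (p := p) e).symm

lemma primePerm_pow_coe {N : Type*} [CommMonoidWithZero N] (e : N ≃* N) (n : ℕ)
    (p : {p : N // Prime p}) : ((primePerm e ^ n) p : N) = e^[n] p.1 := by
  induction n with
  | zero => rfl
  | succ n ih =>
    rw [pow_succ', Equiv.Perm.mul_apply, Function.iterate_succ_apply', ← ih]
    rfl

lemma primeExponents_map (e : N ≃* N) {a : N} (ha : a ≠ 0) (p : {p : N // Prime p}) :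
    primeExponents (e a) (primePerm e p) = primeExponents a p := by
  refine eq_of_forall_le_iff fun n => ?_
  rw [le_primeExponents_iff (by simpa using ha), le_primeExponents_iff ha]
  change (e p.1) ^ n ∣ e a ↔ _
  rw [← map_pow, map_dvd_iff]

end PrimeExponents

/-! ### The free monoid of divisorial ideals of a Krull monoid -/

section DivisorialIdeals

open scoped Pointwise

variable {H : Type*} [CommMonoid H]

lemma mem_colonInv_iff {X : Set (GrothendieckGroup H)} {a : GrothendieckGroup H} :
    a ∈ colonInv X ↔ ∀ x ∈ X, a * x ∈ base H := Iff.rfl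

lemma subset_vClosure (X : Set (GrothendieckGroup H)) : X ⊆ vClosure X := fun x hx y hy => by
  rw [mul_comm]
  exact hy x hx

lemma vClosure_mono {X Y : Set (GrothendieckGroup H)} (h : X ⊆ Y) : vClosure X ⊆ vClosure Y :=
  colonInv_anti (colonInv_anti h)

lemma colonInv_vClosure (X : Set (GrothendieckGroup H)) : colonInv (vClosure X) = colonInv X :=
  (colonInv_anti (subset_vClosure X)).antisymm (subset_vClosure (colonInv X))

lemma vClosure_vClosure (X : Set (GrothendieckGroup H)) : vClosure (vClosure X) = vClosure X := by
  rw [vClosure, colonInv_vClosure]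
  rfl

lemma mem_colonInv_mul {X Y : Set (GrothendieckGroup H)} {a : GrothendieckGroup H} :
    a ∈ colonInv (X * Y) ↔ ∀ y ∈ Y, a * y ∈ colonInv X := by
  constructor
  · intro h y hy x hx
    rw [mul_assoc, mul_comm y]
    exact h _ (Set.mul_mem_mul hx hy)
  · rintro h _ ⟨x, hx, y, hy, rfl⟩
    have := h y hy x hx
    rwa [mul_assoc, mul_comm y] at this

/-- The inverse of a product depends on the first factor only through its inverse. -/
lemma vClosure_mul_left (X Y : Set (GrothendieckGroup H)) :
    vClosure (vClosure X * Y) = vClosure (X * Y) := by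
  have : colonInv (vClosure X * Y) = colonInv (X * Y) := by
    ext a
    rw [mem_colonInv_mul, mem_colonInv_mul, colonInv_vClosure]
  rw [vClosure, this]
  rfl

lemma vClosure_mul_right (X Y : Set (GrothendieckGroup H)) :
    vClosure (X * vClosure Y) = vClosure (X * Y) := by
  rw [mul_comm, vClosure_mul_left, mul_comm]

lemma colonInv_base : colonInv (base H) = base H := by
  ext x
  refine ⟨fun hx => by simpa using hx 1 one_mem_base, fun hx y hy => mul_mem_base hx hy⟩

lemma vClosure_base : vClosure (base H) = base H := by
  rw [vClosure, colonInv_base, colonInv_base]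

lemma vClosure_subset_base {X : Set (GrothendieckGroup H)} (h : X ⊆ base H) :
    vClosure X ⊆ base H := (vClosure_mono h).trans_eq vClosure_base

lemma isDivisorialIdeal_vClosure {X : Set (GrothendieckGroup H)} (h : X ⊆ base H) :
    IsDivisorialIdeal (vClosure X) := by
  refine ⟨⟨⟨fun h a ha y hy => ?_, 1, fun a ha => ?_⟩, vClosure_vClosure X⟩,
    vClosure_subset_base h⟩
  · rw [mul_assoc]
    exact mul_mem_base (of_mem_base _) (ha y hy)
  · rw [map_one, one_mul]
    exact vClosure_subset_base h ha

lemma mul_subset_base {X Y : Set (GrothendieckGroup H)} (hX : X ⊆ base H) (hY : Y ⊆ base H) :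
    X * Y ⊆ base H := by
  rintro _ ⟨x, hx, y, hy, rfl⟩
  exact mul_mem_base (hX hx) (hY hy)

lemma mul_colonInv_subset_base (X : Set (GrothendieckGroup H)) : X * colonInv X ⊆ base H := by
  rintro _ ⟨x, hx, y, hy, rfl⟩
  have := hy x hx
  rwa [mul_comm] at this

lemma base_mul_eq {A : Set (GrothendieckGroup H)} (hA : IsFractionalIdeal A) : base H * A = A := by
  refine Set.Subset.antisymm ?_ fun a ha => ⟨1, one_mem_base, a, ha, one_mul a⟩
  rintro _ ⟨_, ⟨h, rfl⟩, a, ha, rfl⟩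
  exact hA.1 h a ha

variable (H) in
/-- The monoid of nonempty divisorial ideals with `v`-multiplication. -/
@[ext]
structure DivisorialIdeal where
  /-- The underlying set. -/
  carrier : Set (GrothendieckGroup H)
  prop : IsDivisorialIdeal carrier ∧ carrier.Nonempty

namespace DivisorialIdeal

lemma subset_base (A : DivisorialIdeal H) : A.1 ⊆ base H := A.2.1.2

lemma vClosure_eq (A : DivisorialIdeal H) : vClosure A.1 = A.1 := A.2.1.1.2

instance : Mul (DivisorialIdeal H) where
  mul A B := ⟨vClosure (A.1 * B.1), isDivisorialIdeal_vClosure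
    (mul_subset_base A.subset_base B.subset_base), (A.2.2.mul B.2.2).mono (subset_vClosure _)⟩

instance : One (DivisorialIdeal H) where
  one := ⟨base H, by
    have := isDivisorialIdeal_vClosure (Set.Subset.refl (base H))
    rwa [vClosure_base] at this, 1, one_mem_base⟩

lemma coe_mul (A B : DivisorialIdeal H) : (A * B).1 = vClosure (A.1 * B.1) := rfl

lemma coe_one : (1 : DivisorialIdeal H).1 = base H := rfl

instance : CommMonoid (DivisorialIdeal H) where
  mul_assoc A B C := DivisorialIdeal.ext <| by
    rw [coe_mul, coe_mul, coe_mul, coe_mul, vClosure_mul_left, vClosure_mul_right, mul_assoc]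
  one_mul A := DivisorialIdeal.ext <| by
    rw [coe_mul, coe_one, base_mul_eq A.2.1.1.1, A.vClosure_eq]
  mul_one A := DivisorialIdeal.ext <| by
    rw [coe_mul, coe_one, mul_comm, base_mul_eq A.2.1.1.1, A.vClosure_eq]
  mul_comm A B := DivisorialIdeal.ext <| by rw [coe_mul, coe_mul, mul_comm]

lemma subset_of_dvd {A B : DivisorialIdeal H} (h : A ∣ B) : B.1 ⊆ A.1 := by
  obtain ⟨C, rfl⟩ := h
  rw [coe_mul, ← A.vClosure_eq, vClosure_mul_left]
  refine vClosure_mono ?_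
  rw [mul_comm]
  exact (Set.mul_subset_mul_right C.subset_base).trans_eq (base_mul_eq A.2.1.1.1)

/-- In a completely integrally closed monoid divisorial ideals are `v`-invertible. -/
lemma vClosure_mul_colonInv (hH : IsKrullMonoid H) (A : DivisorialIdeal H) :
    vClosure (A.1 * colonInv A.1) = base H := by
  have key : colonInv (A.1 * colonInv A.1) = base H := by
    refine Set.Subset.antisymm (fun x hx => ?_) ?_
    · obtain ⟨a, ha⟩ := A.2.2
      obtain ⟨c, rfl⟩ := A.subset_base ha
      rw [mem_colonInv_mul] at hx
      -- Multiplication by `x` preserves the inverse of `A`. Hence `c * x ^ n` lies in `H` for all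
      -- `n`, which is the setting of complete integral closure.
      have hpow : ∀ n : ℕ, x ^ n ∈ colonInv A.1 := fun n => by
        induction n with
        | zero =>
          intro y hy
          rw [pow_zero, one_mul]
          exact A.subset_base hy
        | succ n ih =>
          rw [pow_succ']
          exact hx _ ih
      refine hH.completelyIntegrallyClosed x ⟨c, fun n _ => ?_⟩
      rw [mul_comm]
      exact hpow n _ ha
    · rw [← colonInv_base (H := H)]
      exact colonInv_anti (mul_colonInv_subset_base _)
  rw [vClosure, key, colonInv_base]

lemma vClosure_mul_mul_colonInv (hH : IsKrullMonoid H) (A B : DivisorialIdeal H) :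
    vClosure (A.1 * B.1 * colonInv A.1) = B.1 := by
  rw [mul_right_comm, ← vClosure_mul_left, vClosure_mul_colonInv hH, base_mul_eq B.2.1.1.1,
    B.vClosure_eq]

/-- To contain is to divide, by v-invertibility: the cofactor is the v-closure of `B` times the
inverse of `A`. -/
lemma dvd_iff (hH : IsKrullMonoid H) {A B : DivisorialIdeal H} : A ∣ B ↔ B.1 ⊆ A.1 := by
  refine ⟨subset_of_dvd, fun h => ?_⟩
  have hsub : B.1 * colonInv A.1 ⊆ base H :=
    (Set.mul_subset_mul_right h).trans (mul_colonInv_subset_base _)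
  have hne : (colonInv A.1).Nonempty := ⟨1, fun y hy => by
    rw [one_mul]
    exact A.subset_base hy⟩
  refine ⟨⟨vClosure (B.1 * colonInv A.1), isDivisorialIdeal_vClosure hsub,
    (B.2.2.mul hne).mono (subset_vClosure _)⟩, DivisorialIdeal.ext ?_⟩
  rw [coe_mul, vClosure_mul_right, ← mul_assoc, vClosure_mul_mul_colonInv hH]

lemma isCancelMul (hH : IsKrullMonoid H) : IsCancelMul (DivisorialIdeal H) :=
  have : IsLeftCancelMul (DivisorialIdeal H) := ⟨fun A B C h => DivisorialIdeal.ext <| by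
    have h' : vClosure (A.1 * B.1) = vClosure (A.1 * C.1) := congrArg carrier h
    rw [← vClosure_mul_mul_colonInv hH A B, ← vClosure_mul_left, h', vClosure_mul_left,
      vClosure_mul_mul_colonInv hH A C]⟩
  CommMagma.IsLeftCancelMul.toIsCancelMul _

lemma eq_one_of_dvd_one {A : DivisorialIdeal H} (h : A ∣ 1) : A = 1 :=
  DivisorialIdeal.ext (A.subset_base.antisymm (subset_of_dvd h))

lemma coe_dvd_coe {M : Type*} [CommMonoid M] {a b : M} :
    (a : WithZero M) ∣ (b : WithZero M) ↔ a ∣ b := by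
  constructor
  · rintro ⟨c, hc⟩
    induction c with
    | zero => simp at hc
    | coe c => exact ⟨c, by exact_mod_cast hc⟩
  · rintro ⟨c, rfl⟩
    exact ⟨c, by simp⟩

lemma isCancelMulZero_withZero {M : Type*} [CommMonoid M] [IsCancelMul M] :
    IsCancelMulZero (WithZero M) :=
  have : IsLeftCancelMulZero (WithZero M) := ⟨fun {a} ha b c h => by
    induction a with
    | zero => exact absurd rfl ha
    | coe a =>
    induction b with
    | zero => induction c with
      | zero => rfl
      | coe c => simp at h
    | coe b => induction c with
      | zero => simp at h
      | coe c =>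
        simp only [← WithZero.coe_mul, WithZero.coe_inj] at h
        rw [mul_left_cancel h]⟩
  IsLeftCancelMulZero.to_isCancelMulZero

lemma subsingleton_units : Subsingleton (WithZero (DivisorialIdeal H))ˣ := by
  refine ⟨fun u v => ?_⟩
  have key : ∀ u : (WithZero (DivisorialIdeal H))ˣ, u = 1 := fun u => by
    refine Units.ext ?_
    have h : (u : WithZero (DivisorialIdeal H)) ∣ 1 := u.isUnit.dvd
    generalize (u : WithZero (DivisorialIdeal H)) = x at h
    induction x with
    | zero => simp at h
    | coe A =>
      rw [← WithZero.coe_one, coe_dvd_coe] at h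
      rw [eq_one_of_dvd_one h]
      rfl
  rw [key u, key v]

lemma wfDvdMonoid (hH : IsKrullMonoid H) : WfDvdMonoid (WithZero (DivisorialIdeal H)) := by
  refine ⟨wellFounded_iff_isEmpty_descending_chain.2 ⟨fun ⟨f, hf⟩ => ?_⟩⟩
  -- The shift is needed because `f 0` may be zero.
  have hne : ∀ n, f (n + 1) ≠ 0 := fun n => (hf n).1
  choose A hA using fun n => WithZero.ne_zero_iff_exists.1 (hne n)
  have hsub : ∀ n, (A n).1 ⊆ (A (n + 1)).1 := fun n => by
    obtain ⟨x, -, hx⟩ := (hf (n + 1)).2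
    refine subset_of_dvd (coe_dvd_coe.1 ?_)
    rw [hA, hA]
    exact ⟨x, hx⟩
  obtain ⟨n, hn⟩ := hH.vNoetherian (fun n => (A n).1) (fun n => (A n).2.1)
    (monotone_nat_of_le_succ hsub)
  obtain ⟨h0, x, hx, hfx⟩ := hf (n + 1)
  have heq : f (n + 1) = f (n + 1 + 1) := by
    rw [← hA, ← hA, DivisorialIdeal.ext (hn (n + 1) (by omega))]
  have := isCancelMul hH
  have := isCancelMulZero_withZero (M := DivisorialIdeal H)
  apply hx
  rw [heq] at hfx
  rw [show x = 1 from (mul_left_cancel₀ h0 (by rw [mul_one]; exact hfx)).symm]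
  exact isUnit_one

/-- The v-closure of `P ∪ A` plays the role of a gcd. If it is `P`, then `P` contains `A`; if it is
`1`, multiplying by `B` shows that `P` contains `B`. -/
lemma dvd_or_dvd_of_irreducible (hH : IsKrullMonoid H) {P A B : DivisorialIdeal H}
    (hP : ∀ C, C ∣ P → C = 1 ∨ C = P) (h : P ∣ A * B) : P ∣ A ∨ P ∣ B := by
  have hsub : P.1 ∪ A.1 ⊆ base H := Set.union_subset P.subset_base A.subset_base
  let C : DivisorialIdeal H := ⟨vClosure (P.1 ∪ A.1), isDivisorialIdeal_vClosure hsub,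
    (P.2.2.mono Set.subset_union_left).mono (subset_vClosure _)⟩
  have hPC : P.1 ⊆ C.1 := Set.subset_union_left.trans (subset_vClosure _)
  have hAC : A.1 ⊆ C.1 := Set.subset_union_right.trans (subset_vClosure _)
  rcases hP C ((dvd_iff hH).2 hPC) with hC | hC
  · right
    have hCB : (P.1 ∪ A.1) * B.1 ⊆ P.1 := by
      rw [Set.union_mul]
      refine Set.union_subset ?_ ?_
      · exact (subset_vClosure _).trans (subset_of_dvd (Dvd.intro B rfl : P ∣ P * B))
      · exact (subset_vClosure _).trans (subset_of_dvd h)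
    refine (dvd_iff hH).2 ?_
    have hB : C * B = B := by rw [hC, one_mul]
    rw [← hB, coe_mul, vClosure_mul_left]
    exact (vClosure_mono hCB).trans_eq P.vClosure_eq
  · left
    refine (dvd_iff hH).2 ?_
    rw [← hC]
    exact hAC

lemma uniqueFactorizationMonoid (hH : IsKrullMonoid H) :
    UniqueFactorizationMonoid (WithZero (DivisorialIdeal H)) := by
  have := isCancelMul hH
  have := isCancelMulZero_withZero (M := DivisorialIdeal H)
  have := wfDvdMonoid hH
  have := subsingleton_units (H := H)
  refine ⟨fun {p} => ⟨fun hp => ⟨hp.ne_zero, hp.not_isUnit, fun x y hxy => ?_⟩,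
    Prime.irreducible⟩⟩
  induction x with
  | zero => simp
  | coe A =>
  induction y with
  | zero => simp
  | coe B =>
  induction p with
  | zero => exact absurd rfl hp.ne_zero
  | coe P =>
  rw [← WithZero.coe_mul, coe_dvd_coe] at hxy
  rw [coe_dvd_coe, coe_dvd_coe]
  refine dvd_or_dvd_of_irreducible hH (fun C hC => ?_) hxy
  obtain ⟨E, rfl⟩ := hC
  rcases hp.isUnit_or_isUnit (WithZero.coe_mul C E) with h | h
  · exact Or.inl (WithZero.coe_injective (isUnit_iff_eq_one.1 h))
  · right
    rw [show E = 1 from WithZero.coe_injective (isUnit_iff_eq_one.1 h), mul_one]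

/-- The principal divisorial ideal generated by an element. -/
def principal (a : H) : DivisorialIdeal H :=
  ⟨vClosure {GrothendieckGroup.of a},
    isDivisorialIdeal_vClosure (Set.singleton_subset_iff.2 (of_mem_base a)),
    (Set.singleton_nonempty _).mono (subset_vClosure _)⟩

lemma principal_mul (a b : H) : principal (a * b) = principal a * principal b := DivisorialIdeal.ext <| by
  rw [coe_mul]
  change vClosure {_} = vClosure (vClosure {_} * vClosure {_})
  rw [vClosure_mul_left, vClosure_mul_right, Set.singleton_mul_singleton, map_mul]

lemma dvd_principal_iff (hH : IsKrullMonoid H) {A : DivisorialIdeal H} {a : H} :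
    A ∣ principal a ↔ GrothendieckGroup.of a ∈ A.1 := by
  rw [dvd_iff hH]
  refine ⟨fun h => h (subset_vClosure _ rfl), fun h => ?_⟩
  rw [← A.vClosure_eq]
  exact vClosure_mono (by simpa using h)

lemma principal_dvd_principal_iff (hH : IsKrullMonoid H) {a b : H} :
    principal a ∣ principal b ↔ a ∣ b := by
  have := hH.cancel
  rw [dvd_principal_iff hH, ← of_dvd_iff]
  constructor
  · intro h
    have := h (GrothendieckGroup.of a)⁻¹ (by
      rintro _ rfl
      rw [inv_mul_cancel]
      exact one_mem_base)
    rwa [← div_eq_mul_inv] at this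
  · intro h y hy
    have := mul_mem_base h (hy _ rfl)
    rwa [mul_comm y, ← mul_assoc, div_mul_cancel] at this

end DivisorialIdeal

/-- The extension of an automorphism of `H` to the quotient group, as an automorphism. -/
noncomputable def extendQuoEquiv (τ : H ≃* H) : GrothendieckGroup H ≃* GrothendieckGroup H :=
  MonoidHom.toMulEquiv (extendQuo τ) (extendQuo τ.symm)
    (by
      refine MonoidHom.ext fun x => ?_
      obtain ⟨a, b, rfl⟩ := exists_eq_of_div_of x
      simp only [MonoidHom.comp_apply, map_div, extendQuo_of, MulEquiv.symm_apply_apply,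
        MonoidHom.id_apply])
    (by
      refine MonoidHom.ext fun x => ?_
      obtain ⟨a, b, rfl⟩ := exists_eq_of_div_of x
      simp only [MonoidHom.comp_apply, map_div, extendQuo_of, MulEquiv.apply_symm_apply,
        MonoidHom.id_apply])

lemma coe_extendQuoEquiv (τ : H ≃* H) : ⇑(extendQuoEquiv τ) = extendQuo τ := rfl

lemma extendQuo_mem_base_iff (τ : H ≃* H) (x : GrothendieckGroup H) :
    extendQuo τ x ∈ base H ↔ x ∈ base H := by
  have key : ∀ (τ : H ≃* H) (x : GrothendieckGroup H), x ∈ base H → extendQuo τ x ∈ base H := by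
    rintro τ _ ⟨a, rfl⟩
    exact ⟨τ a, (extendQuo_of τ a).symm⟩
  refine ⟨fun h => ?_, key τ x⟩
  have := key τ.symm _ h
  rwa [show extendQuo τ.symm (extendQuo τ x) = x from
    (extendQuoEquiv τ).symm_apply_apply x] at this

lemma colonInv_image (τ : H ≃* H) (X : Set (GrothendieckGroup H)) :
    colonInv (extendQuo τ '' X) = extendQuo τ '' colonInv X := by
  ext y
  obtain ⟨x, rfl⟩ := (extendQuoEquiv τ).surjective y
  rw [← coe_extendQuoEquiv, Function.Injective.mem_set_image (extendQuoEquiv τ).injective,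
    coe_extendQuoEquiv]
  constructor
  · intro h z hz
    rw [← extendQuo_mem_base_iff τ, map_mul]
    exact h _ ⟨z, hz, rfl⟩
  · rintro h _ ⟨z, hz, rfl⟩
    rw [← map_mul, extendQuo_mem_base_iff]
    exact h z hz

lemma vClosure_image (τ : H ≃* H) (X : Set (GrothendieckGroup H)) :
    vClosure (extendQuo τ '' X) = extendQuo τ '' vClosure X := by
  rw [vClosure, colonInv_image, colonInv_image]
  rfl

namespace DivisorialIdeal

/-- The image of a divisorial ideal under an automorphism. -/
def map (τ : H ≃* H) (A : DivisorialIdeal H) : DivisorialIdeal H :=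
  ⟨extendQuo τ '' A.1, by
    have : extendQuo τ '' A.1 ⊆ base H := by
      rintro _ ⟨x, hx, rfl⟩
      exact (extendQuo_mem_base_iff τ x).2 (A.subset_base hx)
    have h := isDivisorialIdeal_vClosure this
    rwa [vClosure_image, A.vClosure_eq] at h, A.2.2.image _⟩

lemma map_symm_map (τ : H ≃* H) (A : DivisorialIdeal H) : map τ.symm (map τ A) = A :=
  DivisorialIdeal.ext <| by
    simp only [map, Set.image_image]
    have : ∀ x, extendQuo τ.symm (extendQuo τ x) = x := (extendQuoEquiv τ).symm_apply_apply
    simp only [this, Set.image_id']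

/-- The automorphism of the monoid of divisorial ideals induced by an automorphism. -/
def mapEquiv (τ : H ≃* H) : DivisorialIdeal H ≃* DivisorialIdeal H where
  toFun := map τ
  invFun := map τ.symm
  left_inv := map_symm_map τ
  right_inv A := map_symm_map τ.symm A
  map_mul' A B := DivisorialIdeal.ext <| by
    change extendQuo τ '' vClosure _ = vClosure (extendQuo τ '' _ * extendQuo τ '' _)
    rw [← vClosure_image, Set.image_mul]

lemma mapEquiv_principal (τ : H ≃* H) (a : H) :
    mapEquiv τ (principal a) = principal (τ a) := DivisorialIdeal.ext <| by
  change extendQuo τ '' vClosure _ = vClosure _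
  rw [← vClosure_image, Set.image_singleton, extendQuo_of]

end DivisorialIdeal

/-- The extension of an automorphism by zero. -/
def withZeroEquiv {M : Type*} [CommMonoid M] (e : M ≃* M) : WithZero M ≃* WithZero M where
  toFun := WithZero.map' e.toMonoidHom
  invFun := WithZero.map' e.symm.toMonoidHom
  left_inv x := by induction x <;> simp
  right_inv x := by induction x <;> simp
  map_mul' := map_mul _

lemma withZeroEquiv_iterate_coe {M : Type*} [CommMonoid M] (e : M ≃* M) (n : ℕ) (a : M) :
    (withZeroEquiv e)^[n] (a : WithZero M) = ((e^[n] a : M) : WithZero M) := by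
  induction n with
  | zero => rfl
  | succ n ih =>
    rw [Function.iterate_succ_apply', Function.iterate_succ_apply', ih]
    rfl

/-- The product over one period of the orbit is only cyclically permuted by `e`. -/
lemma exists_dvd_fixed {M : Type*} [CommMonoid M] [IsCancelMul M] (e : M ≃* M) {P : M} {n : ℕ}
    (hn : 0 < n) (h : e^[n] P = P) : ∃ Q, P ∣ Q ∧ e Q = Q := by
  let g : ℕ → M := fun k => e^[k] P
  have hg : ∀ k, e (g k) = g (k + 1) := fun k => (Function.iterate_succ_apply' e k P).symm
  refine ⟨∏ k ∈ Finset.range n, g k,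
    Finset.dvd_prod_of_mem g (Finset.mem_range.2 hn), mul_right_cancel (b := g 0) ?_⟩
  rw [map_prod, Finset.prod_congr rfl fun k _ => hg k, ← Finset.prod_range_succ' g,
    Finset.prod_range_succ]
  congr 1

/-- The divisor theory of a Krull monoid. -/
lemma IsKrullMonoid.exists_isDivisorMap {H : Type u} [CommMonoid H] (hH : IsKrullMonoid H) :
    ∃ (I : Type u) (δ : H → I →₀ ℕ), IsDivisorMap δ ∧
      (∀ a i n, δ a i < n → ∃ u v : H, (∀ c, n ≤ δ c i → v ∣ u * c) ∧ ¬ v ∣ u * a) ∧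
      ∀ τ : H ≃* H, IsVSimple τ → ∃ π : Equiv.Perm I, (∀ a i, δ (τ a) (π i) = δ a i) ∧
        ∀ i n, 0 < n → (π ^ n) i ≠ i := by
  have := hH.cancel
  have := DivisorialIdeal.isCancelMul hH
  have := DivisorialIdeal.subsingleton_units (H := H)
  have := DivisorialIdeal.uniqueFactorizationMonoid hH
  have hne : ∀ A : DivisorialIdeal H, (A : WithZero (DivisorialIdeal H)) ≠ 0 :=
    fun A => WithZero.coe_ne_zero
  refine ⟨{p : WithZero (DivisorialIdeal H) // Prime p},
    fun a => primeExponents (DivisorialIdeal.principal a : WithZero (DivisorialIdeal H)),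
    ⟨fun a b => ?_, fun a b => ?_⟩, fun a p n h => ?_, fun τ hτ => ?_⟩
  · rw [DivisorialIdeal.principal_mul, WithZero.coe_mul, primeExponents_mul (hne _) (hne _)]
  · rw [← dvd_iff_primeExponents_le (hne _) (hne _), DivisorialIdeal.coe_dvd_coe,
      DivisorialIdeal.principal_dvd_principal_iff hH]
  · obtain ⟨p, hp⟩ := p
    induction p with
    | zero => exact absurd rfl hp.ne_zero
    | coe P =>
    have hmem : ∀ c, n ≤ primeExponents
        (DivisorialIdeal.principal c : WithZero (DivisorialIdeal H)) ⟨P, hp⟩ ↔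
        GrothendieckGroup.of c ∈ (P ^ n).1 := fun c => by
      rw [← DivisorialIdeal.dvd_principal_iff hH, ← DivisorialIdeal.coe_dvd_coe, WithZero.coe_pow]
      exact le_primeExponents_iff (hne _) _ _
    have ha : GrothendieckGroup.of a ∉ (P ^ n).1 := fun hmem' => by
      exact h.not_ge ((hmem a).2 hmem')
    -- Since `P ^ n` is its own double inverse, some fraction `u / v` in its inverse detects that
    -- `a` is missing. In a domain this separation makes the components valuations.
    rw [← DivisorialIdeal.vClosure_eq, vClosure, mem_colonInv_iff] at ha
    push Not at ha
    obtain ⟨y, hy, hya⟩ := ha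
    obtain ⟨u, v, rfl⟩ := exists_eq_of_div_of y
    refine ⟨u, v, fun c hc => ?_, fun hdvd => hya ?_⟩
    · rw [← of_dvd_iff, map_mul, mul_div_right_comm]
      exact hy _ ((hmem c).1 hc)
    · rw [← of_dvd_iff, map_mul, mul_comm, mul_div_assoc] at hdvd
      exact hdvd
  · let e := DivisorialIdeal.mapEquiv τ
    refine ⟨primePerm (withZeroEquiv e), fun a p => ?_, fun p n hn hfix => ?_⟩
    · have := primeExponents_map (withZeroEquiv e) (hne (DivisorialIdeal.principal a)) p
      rw [← this]
      simp only [← DivisorialIdeal.mapEquiv_principal]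
      rfl
    · obtain ⟨p, hp⟩ := p
      induction p with
      | zero => exact absurd rfl hp.ne_zero
      | coe P =>
      have hfix' : e^[n] P = P := by
        have := congrArg Subtype.val hfix
        rw [primePerm_pow_coe, withZeroEquiv_iterate_coe] at this
        exact WithZero.coe_injective this
      obtain ⟨Q, hPQ, hQ⟩ := exists_dvd_fixed e hn hfix'
      have hQ' : extendQuo τ '' Q.carrier = Q.carrier := congrArg DivisorialIdeal.carrier hQ
      have hQbase : Q.carrier ≠ base H := fun hbase => by
        have hQ1 : Q = 1 := DivisorialIdeal.ext hbase
        rw [hQ1] at hPQ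
        have hP : P = 1 := DivisorialIdeal.eq_one_of_dvd_one hPQ
        have hunit : ¬ IsUnit (P : WithZero (DivisorialIdeal H)) := hp.not_isUnit
        rw [hP, WithZero.coe_one] at hunit
        exact hunit isUnit_one
      exact hτ Q.carrier Q.prop.1.1 Q.prop.2 hQbase hQ'

end DivisorialIdeals

/-! ### Divisor maps and valuations on domains -/

section RingDivisorMap

/-- A divisor map on the nonzero elements of a commutative ring. -/
structure IsRingDivisorMap {R : Type*} [CommRing R] {I : Type*} (δ : R → I →₀ ℕ) : Prop where
  map_mul : ∀ {a b}, a ≠ 0 → b ≠ 0 → δ (a * b) = δ a + δ b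
  dvd_iff : ∀ {a b}, a ≠ 0 → b ≠ 0 → (a ∣ b ↔ δ a ≤ δ b)

/-- A divisor map all of whose components are valuations. -/
structure IsValuativeDivisorMap {R : Type*} [CommRing R] {I : Type*} (δ : R → I →₀ ℕ) : Prop
    extends IsRingDivisorMap δ where
  le_add : ∀ {i n a b}, a ≠ 0 → b ≠ 0 → a + b ≠ 0 → n ≤ δ a i → n ≤ δ b i → n ≤ δ (a + b) i

lemma coe_dvd_coe_nonZeroDivisors {R : Type*} [CommRing R] {a b : R⁰} :
    (a : R) ∣ (b : R) ↔ a ∣ b := by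
  constructor
  · rintro ⟨c, hc⟩
    have hc' : c ∈ R⁰ := by
      have hb := b.2
      rw [hc] at hb
      exact (mul_mem_nonZeroDivisors.1 hb).2
    exact ⟨⟨c, hc'⟩, Subtype.ext hc⟩
  · rintro ⟨c, rfl⟩
    exact ⟨c, rfl⟩

variable {R : Type*} [CommRing R] {I : Type*}

lemma IsRingDivisorMap.isDivisorMap [IsDomain R] {δ : R → I →₀ ℕ} (h : IsRingDivisorMap δ) :
    IsDivisorMap fun a : R⁰ => δ a where
  map_mul a b := h.map_mul (nonZeroDivisors.coe_ne_zero a) (nonZeroDivisors.coe_ne_zero b)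
  dvd_iff a b := by
    rw [← coe_dvd_coe_nonZeroDivisors,
      h.dvd_iff (nonZeroDivisors.coe_ne_zero a) (nonZeroDivisors.coe_ne_zero b)]

lemma isCancelMul_nonZeroDivisors [IsDomain R] : IsCancelMul R⁰ :=
  have : IsLeftCancelMul R⁰ := ⟨fun a _ _ h => Subtype.ext <|
    mul_left_cancel₀ (nonZeroDivisors.coe_ne_zero a) (congrArg Subtype.val h)⟩
  CommMagma.IsLeftCancelMul.toIsCancelMul _

lemma restrictNonZero_coe (σ : R ≃+* R) (a : R⁰) : (restrictNonZero σ a : R) = σ a := rfl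

lemma IsRingDivisorMap.isKrullDomain [IsDomain R] {δ : R → I →₀ ℕ} (h : IsRingDivisorMap δ) :
    IsKrullDomain R :=
  have := isCancelMul_nonZeroDivisors (R := R)
  ⟨inferInstance, h.isDivisorMap.isKrullMonoid⟩

lemma IsRingDivisorMap.isVSimpleRing [IsDomain R] {δ : R → I →₀ ℕ} (h : IsRingDivisorMap δ)
    (σ : R ≃+* R) (π : Equiv.Perm I) (hπ : ∀ a, a ≠ 0 → ∀ i, δ (σ a) (π i) = δ a i)
    (hinf : ∀ i n, 0 < n → (π ^ n) i ≠ i) : IsVSimpleRing σ :=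
  have := isCancelMul_nonZeroDivisors (R := R)
  h.isDivisorMap.isVSimple _ π (fun a i => hπ a (nonZeroDivisors.coe_ne_zero a) i) hinf

/-- The divisor theory of a Krull domain consists of valuations. -/
lemma IsKrullDomain.exists_isValuativeDivisorMap {R : Type u} [CommRing R]
    (hR : IsKrullDomain R) : ∃ (I : Type u) (δ : R → I →₀ ℕ), IsValuativeDivisorMap δ ∧
      ∀ σ : R ≃+* R, IsVSimpleRing σ → ∃ π : Equiv.Perm I,
        (∀ a, a ≠ 0 → ∀ i, δ (σ a) (π i) = δ a i) ∧ ∀ i n, 0 < n → (π ^ n) i ≠ i := by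
  classical
  have := hR.isDomain
  obtain ⟨I, δ, hδ, hsep, hτ⟩ := hR.isKrullMonoid.exists_isDivisorMap
  let δ' : R → I →₀ ℕ := fun a => if h : a ∈ R⁰ then δ ⟨a, h⟩ else 0
  have hcoe : ∀ a : R⁰, δ' a = δ a := fun a => dif_pos a.2
  have hlift : ∀ {a : R}, a ≠ 0 → ∃ a' : R⁰, (a' : R) = a :=
    fun {a} ha => ⟨⟨a, mem_nonZeroDivisors_of_ne_zero ha⟩, rfl⟩
  refine ⟨I, δ', ⟨⟨fun {a b} ha hb => ?_, fun {a b} ha hb => ?_⟩,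
    fun {i n a b} ha hb hab hna hnb => ?_⟩, fun σ hσ => ?_⟩
  · obtain ⟨a, rfl⟩ := hlift ha
    obtain ⟨b, rfl⟩ := hlift hb
    rw [← Submonoid.coe_mul, hcoe, hcoe, hcoe, hδ.map_mul]
  · obtain ⟨a, rfl⟩ := hlift ha
    obtain ⟨b, rfl⟩ := hlift hb
    rw [hcoe, hcoe, coe_dvd_coe_nonZeroDivisors, hδ.dvd_iff]
  · obtain ⟨a, rfl⟩ := hlift ha
    obtain ⟨b, rfl⟩ := hlift hb
    obtain ⟨c, hc⟩ := hlift hab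
    rw [← hc, hcoe]
    rw [hcoe] at hna hnb
    by_contra! hlt
    obtain ⟨u, v, huv, hnot⟩ := hsep c i n hlt
    -- The conditions `v ∣ u * a` and `v ∣ u * b` add up, contradicting the separation of `c = a +
    -- b`.
    apply hnot
    rw [← coe_dvd_coe_nonZeroDivisors, Submonoid.coe_mul, hc, mul_add]
    exact dvd_add (coe_dvd_coe_nonZeroDivisors.2 (huv a hna))
      (coe_dvd_coe_nonZeroDivisors.2 (huv b hnb))
  · obtain ⟨π, hπ, hinf⟩ := hτ _ hσ
    refine ⟨π, fun a ha i => ?_, hinf⟩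
    obtain ⟨a, rfl⟩ := hlift ha
    rw [← restrictNonZero_coe, hcoe, hcoe, hπ]

namespace IsValuativeDivisorMap

variable {δ : R → I →₀ ℕ}

/-- The elements whose valuation at `i` is at least `n`. -/
def leSubgroup (h : IsValuativeDivisorMap δ) (i : I) (n : ℕ) : AddSubgroup R where
  carrier := {a | a ≠ 0 → n ≤ δ a i}
  zero_mem' h0 := absurd rfl h0
  add_mem' {a b} ha hb hab := by
    by_cases ha0 : a = 0
    · rw [ha0, zero_add] at hab ⊢
      exact hb hab
    by_cases hb0 : b = 0
    · rw [hb0, add_zero]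
      exact ha ha0
    exact h.le_add ha0 hb0 hab (ha ha0) (hb hb0)
  neg_mem' {a} ha hna := by
    have ha0 : a ≠ 0 := by simpa using hna
    exact (ha ha0).trans ((h.dvd_iff ha0 hna).1 (dvd_neg.2 dvd_rfl) i)

lemma mem_leSubgroup (h : IsValuativeDivisorMap δ) {i : I} {n : ℕ} {a : R} :
    a ∈ h.leSubgroup i n ↔ (a ≠ 0 → n ≤ δ a i) := Iff.rfl

end IsValuativeDivisorMap

end RingDivisorMap

/-! ### Contents and divisibility of polynomials -/

section Content

variable {R : Type*} [CommRing R] {I J : Type*}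

open MvPolynomial

open Classical in
/-- The componentwise minimum of a divisor map over the nonzero coefficients of a polynomial. -/
noncomputable def content (δ : R → I →₀ ℕ) (f : MvPolynomial J R) : I →₀ ℕ :=
  if h : f.support.Nonempty then f.support.inf' h fun m => δ (coeff m f) else 0

lemma le_content_iff (δ : R → I →₀ ℕ) {f : MvPolynomial J R} (hf : f ≠ 0) (i : I) (n : ℕ) :
    n ≤ content δ f i ↔ ∀ m, coeff m f ≠ 0 → n ≤ δ (coeff m f) i := by
  have h : f.support.Nonempty := support_nonempty.2 hf
  have key : content δ f i = f.support.inf' h fun m => δ (coeff m f) i := by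
    rw [content, dif_pos h]
    exact Finset.apply_inf'_eq_inf'_comp h (fun v : I →₀ ℕ => v i) fun x y =>
      Finsupp.inf_apply _ _ _
  rw [key, Finset.le_inf'_iff]
  simp only [mem_support_iff]

lemma exists_content_eq (δ : R → I →₀ ℕ) {f : MvPolynomial J R} (hf : f ≠ 0) (i : I) :
    ∃ m, coeff m f ≠ 0 ∧ δ (coeff m f) i = content δ f i := by
  by_contra! hne
  have : content δ f i + 1 ≤ content δ f i := (le_content_iff δ hf i _).2 fun m hm =>
    lt_of_le_of_ne ((le_content_iff δ hf i _).1 le_rfl m hm) (hne m hm).symm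
  omega

lemma content_C (δ : R → I →₀ ℕ) {d : R} (hd : d ≠ 0) :
    content δ (C d : MvPolynomial J R) = δ d := by
  classical
  have hC : (C d : MvPolynomial J R) ≠ 0 := by simpa using hd
  ext i
  refine eq_of_forall_le_iff fun n => ?_
  rw [le_content_iff δ hC]
  refine ⟨fun hn => by simpa [hd] using hn 0, fun hn m hm => ?_⟩
  rw [coeff_C] at hm ⊢
  split_ifs at hm ⊢ with h0
  · exact hn
  · exact absurd rfl hm

lemma map_algebraMap_ne_zero (K : Type*) [Field K] [Algebra R K] [IsFractionRing R K]
    {f : MvPolynomial J R} (hf : f ≠ 0) :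
    Associates.mk (map (algebraMap R K) f) ≠ 0 := by
  rw [Associates.mk_ne_zero]
  exact (map_ne_zero_iff _ (map_injective _ (IsFractionRing.injective R K))).2 hf

variable [IsDomain R] {δ : R → I →₀ ℕ}

/-- Gauss's lemma. -/
lemma IsValuativeDivisorMap.content_mul (h : IsValuativeDivisorMap δ) {f g : MvPolynomial J R}
    (hf : f ≠ 0) (hg : g ≠ 0) : content δ (f * g) = content δ f + content δ g := by
  classical
  have hfg : f * g ≠ 0 := mul_ne_zero hf hg
  ext i
  rw [Finsupp.add_apply]
  have hfle := (le_content_iff δ hf i _).1 le_rfl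
  have hgle := (le_content_iff δ hg i _).1 le_rfl
  refine le_antisymm ?_ ?_
  · let A := f.support.filter fun m => δ (coeff m f) i = content δ f i
    let B := g.support.filter fun m => δ (coeff m g) i = content δ g i
    have hA : A.Nonempty := by
      obtain ⟨m, hm, hm'⟩ := exists_content_eq δ hf i
      exact ⟨m, by simp [A, hm, hm']⟩
    have hB : B.Nonempty := by
      obtain ⟨m, hm, hm'⟩ := exists_content_eq δ hg i
      exact ⟨m, by simp [B, hm, hm']⟩
    -- Among the monomials of minimal valuation, choose a pair whose sum arises in only one way;
    -- this replaces a comparison of leading monomials.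
    obtain ⟨a, ha, b, hb, hab⟩ := UniqueSums.uniqueAdd_of_nonempty hA hB
    simp only [A, Finset.mem_filter, mem_support_iff] at ha
    simp only [B, Finset.mem_filter, mem_support_iff] at hb
    have hab0 : coeff a f * coeff b g ≠ 0 := mul_ne_zero ha.1 hb.1
    have hδab : δ (coeff a f * coeff b g) i = content δ f i + content δ g i := by
      rw [h.map_mul ha.1 hb.1, Finsupp.add_apply, ha.2, hb.2]
    -- Every other contribution to this coefficient has strictly larger valuation, so nothing
    -- cancels the chosen product.
    have hcoeff : coeff (a + b) (f * g) ∉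
        h.leSubgroup i (content δ f i + content δ g i + 1) := fun hmem => by
      rw [coeff_mul, ← Finset.add_sum_erase _ _
          (Finset.HasAntidiagonal.mem_antidiagonal.2 (rfl : (a, b).1 + (a, b).2 = a + b)),
        AddSubgroup.add_mem_cancel_right] at hmem
      · have := hmem hab0
        rw [hδab] at this
        omega
      · refine sum_mem fun x hx => ?_
        rw [Finset.mem_erase, Finset.HasAntidiagonal.mem_antidiagonal] at hx
        intro hx0
        have hx1 : coeff x.1 f ≠ 0 := left_ne_zero_of_mul hx0
        have hx2 : coeff x.2 g ≠ 0 := right_ne_zero_of_mul hx0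
        rw [h.map_mul hx1 hx2, Finsupp.add_apply]
        have h1 := hfle _ hx1
        have h2 := hgle _ hx2
        by_contra! hlt
        have hxA : x.1 ∈ A := by
          simp only [A, Finset.mem_filter, mem_support_iff]
          exact ⟨hx1, by omega⟩
        have hxB : x.2 ∈ B := by
          simp only [B, Finset.mem_filter, mem_support_iff]
          exact ⟨hx2, by omega⟩
        obtain ⟨e1, e2⟩ := hab hxA hxB hx.2
        exact hx.1 (Prod.ext e1 e2)
    rw [h.mem_leSubgroup] at hcoeff
    push Not at hcoeff
    have := (le_content_iff δ hfg i _).1 le_rfl _ hcoeff.1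
    omega
  · rw [le_content_iff δ hfg]
    intro k
    rw [← h.mem_leSubgroup, coeff_mul]
    refine sum_mem fun x _ hx0 => ?_
    have hx1 : coeff x.1 f ≠ 0 := left_ne_zero_of_mul hx0
    have hx2 : coeff x.2 g ≠ 0 := right_ne_zero_of_mul hx0
    rw [h.map_mul hx1 hx2, Finsupp.add_apply]
    exact add_le_add (hfle _ hx1) (hgle _ hx2)

variable (K : Type*) [Field K] [Algebra R K] [IsFractionRing R K]

/-- Clear the denominator `d` of the quotient over `K`. By Gauss's lemma the content inequality
forces `d` to divide all coefficients of the numerator. -/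
lemma IsValuativeDivisorMap.mvPolynomial_dvd_iff (h : IsValuativeDivisorMap δ)
    {f g : MvPolynomial J R} (hf : f ≠ 0) (hg : g ≠ 0) :
    f ∣ g ↔ map (algebraMap R K) f ∣ map (algebraMap R K) g ∧ content δ f ≤ content δ g := by
  have hinj : Function.Injective (map (algebraMap R K) : MvPolynomial J R → MvPolynomial J K) :=
    map_injective _ (IsFractionRing.injective R K)
  constructor
  · rintro ⟨c, rfl⟩
    refine ⟨by rw [map_mul]; exact dvd_mul_right _ _, ?_⟩
    rw [h.content_mul hf (right_ne_zero_of_mul hg)]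
    exact le_self_add
  · rintro ⟨⟨c, hc⟩, hle⟩
    let : Algebra (MvPolynomial J R) (MvPolynomial J K) := algebraMvPolynomial
    obtain ⟨⟨c', b⟩, hb⟩ := IsLocalization.surj (Submonoid.map (C (σ := J)) R⁰) c
    obtain ⟨b, d, hd, rfl⟩ := b
    have hd0 : d ≠ 0 := nonZeroDivisors.ne_zero hd
    simp only [algebraMap_def] at hb
    have hmul : C d * g = f * c' := hinj <| by
      rw [map_mul, map_mul, hc, ← hb]
      ring
    have hC : (C d : MvPolynomial J R) ≠ 0 := by simpa using hd0
    have hc'0 : c' ≠ 0 := by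
      rintro rfl
      rw [mul_zero] at hmul
      exact mul_ne_zero hC hg hmul
    have hcontent := congrArg (content δ) hmul
    rw [h.content_mul hC hg, h.content_mul hf hc'0, content_C δ hd0] at hcontent
    have hdc : C d ∣ c' := by
      rw [C_dvd_iff_dvd_coeff]
      intro m
      by_cases hm : coeff m c' = 0
      · rw [hm]
        exact dvd_zero _
      · refine (h.dvd_iff hd0 hm).2 fun i => ?_
        have h1 := (le_content_iff δ hc'0 i _).1 le_rfl m hm
        have h2 := DFunLike.congr_fun hcontent i
        have h3 := hle i
        simp only [Finsupp.add_apply] at h2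
        omega
    obtain ⟨e, rfl⟩ := hdc
    refine ⟨e, mul_left_cancel₀ hC ?_⟩
    rw [hmul]
    ring

/-- The divisor map of a polynomial ring over a ring with a valuative divisor map. -/
noncomputable def polyDivisor (δ : R → I →₀ ℕ) (f : MvPolynomial J R) :
    I ⊕ {p : Associates (MvPolynomial J K) // Prime p} →₀ ℕ :=
  Finsupp.sumElim (content δ f) (primeExponents (Associates.mk (map (algebraMap R K) f)))

lemma IsValuativeDivisorMap.isRingDivisorMap_polyDivisor (h : IsValuativeDivisorMap δ) :
    IsRingDivisorMap (polyDivisor (J := J) K δ) where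
  map_mul {f g} hf hg := by
    ext x
    rw [polyDivisor, h.content_mul hf hg, _root_.map_mul, ← Associates.mk_mul_mk,
      primeExponents_mul (map_algebraMap_ne_zero K hf) (map_algebraMap_ne_zero K hg)]
    cases x <;> simp [polyDivisor]
  dvd_iff {f g} hf hg := by
    rw [h.mvPolynomial_dvd_iff K hf hg, ← Associates.mk_dvd_mk,
      dvd_iff_primeExponents_le (map_algebraMap_ne_zero K hf) (map_algebraMap_ne_zero K hg)]
    constructor
    · rintro ⟨h1, h2⟩ (x | x)
      · exact h2 x
      · exact h1 x
    · intro h'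
      exact ⟨fun x => h' (Sum.inr x), fun x => h' (Sum.inl x)⟩

end Content

open MvPolynomial

/-! ### Embedding the monoid algebra in a polynomial ring -/

section MonoidAlgebra

lemma exists_monoidAlgebra_coeff_eq {D : Type*} [CommRing D] {H J : Type*} {δ : H → J →₀ ℕ}
    (hinj : Function.Injective δ) (c : MvPolynomial J D) :
    ∃ f : MonoidAlgebra D H, ∀ a, f.coeff a = coeff (δ a) c := by
  refine ⟨.ofCoeff (Finsupp.ofSupportFinite (fun a => coeff (δ a) c)
    ((c.support.finite_toSet.preimage hinj.injOn).subset fun a ha => ?_)), fun a => rfl⟩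
  simpa using ha

variable {D : Type*} [CommRing D] {H : Type*} [CommMonoid H] {J : Type*} {δ : H → J →₀ ℕ}

/-- The homomorphism from a monoid algebra to a polynomial ring induced by a divisor map. -/
noncomputable def IsDivisorMap.toMvPolynomial (h : IsDivisorMap δ) (D : Type*) [CommRing D] :
    MonoidAlgebra D H →ₐ[D] MvPolynomial J D :=
  MonoidAlgebra.lift D (MvPolynomial J D) H
    { toFun := fun a => monomial (δ a) 1
      map_one' := by
        have h1 : δ 1 = 0 := by simpa using h.map_mul 1 1
        rw [h1]
        rfl
      map_mul' := fun a b => by rw [h.map_mul, monomial_mul, one_mul] }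

namespace IsDivisorMap

lemma toMvPolynomial_single (h : IsDivisorMap δ) (a : H) (d : D) :
    h.toMvPolynomial D (MonoidAlgebra.single a d) = monomial (δ a) d := by
  rw [toMvPolynomial, MonoidAlgebra.lift_single]
  simp [smul_monomial]

lemma coeff_toMvPolynomial_of_notMem (h : IsDivisorMap δ) (f : MonoidAlgebra D H) {m : J →₀ ℕ}
    (hm : m ∉ Set.range δ) : coeff m (h.toMvPolynomial D f) = 0 := by
  classical
  induction f using MonoidAlgebra.induction_linear with
  | zero => simp
  | add f g hf hg => rw [map_add, coeff_add, hf, hg, add_zero]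
  | single a d =>
    rw [toMvPolynomial_single, coeff_monomial, if_neg]
    rintro rfl
    exact hm ⟨a, rfl⟩

lemma coeff_toMvPolynomial (h : IsDivisorMap δ) (hinj : Function.Injective δ)
    (f : MonoidAlgebra D H) (a : H) : coeff (δ a) (h.toMvPolynomial D f) = f.coeff a := by
  classical
  induction f using MonoidAlgebra.induction_linear with
  | zero => simp
  | add f g hf hg => rw [map_add, coeff_add, hf, hg]; rfl
  | single b d =>
    rw [toMvPolynomial_single, coeff_monomial, MonoidAlgebra.coeff_single, Finsupp.single_apply]
    simp only [hinj.eq_iff]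

lemma toMvPolynomial_injective (h : IsDivisorMap δ) (hinj : Function.Injective δ) :
    Function.Injective (h.toMvPolynomial D) := fun f g hfg => by
  refine MonoidAlgebra.ext (Finsupp.ext fun a => ?_)
  rw [← h.coeff_toMvPolynomial hinj, ← h.coeff_toMvPolynomial hinj, hfg]

/-- The image of the monoid algebra in the polynomial ring is divisor-closed. -/
lemma toMvPolynomial_dvd_iff [IsDomain D] (h : IsDivisorMap δ) (hinj : Function.Injective δ)
    {a b : MonoidAlgebra D H} (ha : a ≠ 0) :
    h.toMvPolynomial D a ∣ h.toMvPolynomial D b ↔ a ∣ b := by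
  classical
  refine ⟨fun ⟨c, hc⟩ => ?_, fun hab => map_dvd _ hab⟩
  -- `c'` is the part of the quotient supported on the image of `H`; the aim is that nothing else
  -- remains.
  obtain ⟨c', hc'⟩ := exists_monoidAlgebra_coeff_eq hinj c
  have hcoeff : ∀ k, coeff (δ k) (c - h.toMvPolynomial D c') = 0 := fun k => by
    rw [coeff_sub, h.coeff_toMvPolynomial hinj, hc', sub_self]
  have himage : h.toMvPolynomial D a * (c - h.toMvPolynomial D c') =
      h.toMvPolynomial D (b - a * c') := by
    rw [map_sub, _root_.map_mul, hc]
    ring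
  -- Outside the image of `H` coefficients vanish because the product comes from the monoid algebra.
  -- Inside it, `δ y ≤ δ k` gives `y ∣ k`, so the cofactor's exponent is again in the image, where
  -- the remainder has no coefficient.
  have hzero : h.toMvPolynomial D a * (c - h.toMvPolynomial D c') = 0 := by
    ext m
    rw [coeff_zero]
    by_cases hm : m ∈ Set.range δ
    · obtain ⟨k, rfl⟩ := hm
      rw [coeff_mul]
      refine Finset.sum_eq_zero fun x hx => ?_
      rw [Finset.HasAntidiagonal.mem_antidiagonal] at hx
      by_cases hx1 : x.1 ∈ Set.range δ
      · obtain ⟨y, hy⟩ := hx1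
        obtain ⟨z, rfl⟩ := (h.dvd_iff y k).2 (by rw [hy, ← hx]; exact le_self_add)
        rw [h.map_mul, hy] at hx
        rw [add_left_cancel hx, hcoeff, mul_zero]
      · rw [h.coeff_toMvPolynomial_of_notMem a hx1, zero_mul]
    · rw [himage]
      exact h.coeff_toMvPolynomial_of_notMem _ hm
  have ha' : h.toMvPolynomial D a ≠ 0 :=
    (map_ne_zero_iff _ (h.toMvPolynomial_injective hinj)).2 ha
  have hc0 := sub_eq_zero.1 ((mul_eq_zero.1 hzero).resolve_left ha')
  refine ⟨c', h.toMvPolynomial_injective hinj ?_⟩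
  rw [_root_.map_mul, hc, ← hc0]

lemma injective_of_isReducedMonoid [IsCancelMul H] (h : IsDivisorMap δ)
    (hred : IsReducedMonoid H) : Function.Injective δ := fun a b hab => by
  obtain ⟨c, rfl⟩ := (h.dvd_iff a b).2 hab.le
  obtain ⟨e, he⟩ := (h.dvd_iff (a * c) a).2 hab.ge
  have : c * e = 1 := mul_left_cancel (a := a) (by rw [mul_one, ← mul_assoc, ← he])
  rw [hred c (IsUnit.of_mul_eq_one e this), mul_one]

end IsDivisorMap

end MonoidAlgebra

/-! ### Automorphisms of polynomial rings and orbits of primes -/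

section PolyAut

variable {A : Type*} [CommRing A] {J : Type*}

/-- The automorphism of a polynomial ring that acts on the coefficients by `σ` and permutes the
variables by `π`. -/
noncomputable def polyAut (σ : A ≃+* A) (π : Equiv.Perm J) :
    MvPolynomial J A ≃+* MvPolynomial J A :=
  (mapEquiv J σ).trans (renameEquiv A π).toRingEquiv

lemma coeff_polyAut (σ : A ≃+* A) (π : Equiv.Perm J) (f : MvPolynomial J A) (m : J →₀ ℕ) :
    coeff (m.mapDomain π) (polyAut σ π f) = σ (coeff m f) := by
  change coeff (m.mapDomain π) (rename π (map (σ : A →+* A) f)) = _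
  rw [coeff_rename_mapDomain _ π.injective, coeff_map]
  rfl

lemma polyAut_monomial (σ : A ≃+* A) (π : Equiv.Perm J) (m : J →₀ ℕ) (a : A) :
    polyAut σ π (monomial m a) = monomial (m.mapDomain π) (σ a) := by
  change rename π (map (σ : A →+* A) (monomial m a)) = _
  rw [map_monomial, rename_monomial]
  rfl

lemma mapDomain_surjective (π : Equiv.Perm J) (m : J →₀ ℕ) :
    ∃ m' : J →₀ ℕ, m'.mapDomain π = m :=
  ⟨m.mapDomain π.symm, by rw [← Finsupp.mapDomain_comp]; simp⟩

lemma content_polyAut {I : Type*} {δ : A → I →₀ ℕ} (σ : A ≃+* A) (π : Equiv.Perm J)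
    (ρ : Equiv.Perm I) (hρ : ∀ a, a ≠ 0 → ∀ i, δ (σ a) (ρ i) = δ a i) {f : MvPolynomial J A}
    (hf : f ≠ 0) (i : I) : content δ (polyAut σ π f) (ρ i) = content δ f i := by
  refine eq_of_forall_le_iff fun n => ?_
  rw [le_content_iff δ (by simpa using hf), le_content_iff δ hf]
  constructor
  · intro h m hm
    have := h (m.mapDomain π)
    rw [coeff_polyAut, hρ _ hm] at this
    exact this (by simpa using hm)
  · intro h m hm
    obtain ⟨m, rfl⟩ := mapDomain_surjective π m
    rw [coeff_polyAut] at hm ⊢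
    have hm' : coeff m f ≠ 0 := by simpa using hm
    rw [hρ _ hm']
    exact h m hm'

lemma map_polyAut {B : Type*} [CommRing B] (g : A →+* B) (σ : A ≃+* A) (σ' : B ≃+* B)
    (hσ : ∀ a, g (σ a) = σ' (g a)) (π : Equiv.Perm J) (f : MvPolynomial J A) :
    map g (polyAut σ π f) = polyAut σ' π (map g f) := by
  ext m
  obtain ⟨m, rfl⟩ := mapDomain_surjective π m
  rw [coeff_map, coeff_polyAut, coeff_polyAut, coeff_map, hσ]

/-- The automorphism of the monoid of associate classes induced by an automorphism. -/
noncomputable def associatesEquiv {M : Type*} [CommMonoid M] (e : M ≃* M) :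
    Associates M ≃* Associates M where
  toFun := Quotient.map e fun _ _ h => h.map e
  invFun := Quotient.map e.symm fun _ _ h => h.map e.symm
  left_inv x := by
    obtain ⟨x, rfl⟩ := Quotient.exists_rep x
    rw [Quotient.map_mk, Quotient.map_mk, e.symm_apply_apply]
  right_inv x := by
    obtain ⟨x, rfl⟩ := Quotient.exists_rep x
    rw [Quotient.map_mk, Quotient.map_mk, e.apply_symm_apply]
  map_mul' x y := by
    obtain ⟨x, rfl⟩ := Associates.mk_surjective x
    obtain ⟨y, rfl⟩ := Associates.mk_surjective y
    exact congrArg Associates.mk (map_mul e x y)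

lemma associatesEquiv_mk {M : Type*} [CommMonoid M] (e : M ≃* M) (x : M) :
    associatesEquiv e (Associates.mk x) = Associates.mk (e x) := rfl

lemma associatesEquiv_iterate_mk {M : Type*} [CommMonoid M] (e : M ≃* M) (n : ℕ) (x : M) :
    (associatesEquiv e)^[n] (Associates.mk x) = Associates.mk (e^[n] x) := by
  induction n with
  | zero => rfl
  | succ n ih =>
    rw [Function.iterate_succ_apply', Function.iterate_succ_apply', ih, associatesEquiv_mk]

/-- Pigeonhole on the iterates; injectivity removes the preperiod. -/
lemma exists_iterate_eq_of_mapsTo {α : Type*} {T : α → α} (hT : Function.Injective T)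
    {s : Set α} (hs : s.Finite) (hmaps : Set.MapsTo T s s) {x : α} (hx : x ∈ s) :
    ∃ k, 0 < k ∧ T^[k] x = x := by
  obtain ⟨k, l, hkl, heq⟩ := hs.exists_lt_map_eq_of_forall_mem
    (f := fun k : ℕ => T^[k] x) fun k => hmaps.iterate k hx
  refine ⟨l - k, by omega, hT.iterate k ?_⟩
  rw [← Function.iterate_add_apply, Nat.add_sub_cancel' hkl.le]
  exact heq.symm

lemma coeff_polyAut_iterate (σ : A ≃+* A) (π : Equiv.Perm J) (n : ℕ) (f : MvPolynomial J A)
    (m : J →₀ ℕ) :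
    coeff ((Finsupp.mapDomain π)^[n] m) ((polyAut σ π)^[n] f) ≠ 0 ↔ coeff m f ≠ 0 := by
  induction n with
  | zero => rfl
  | succ n ih =>
    rw [Function.iterate_succ_apply', Function.iterate_succ_apply', coeff_polyAut, ← ih]
    simp

lemma mapDomain_iterate_apply (π : Equiv.Perm J) (n : ℕ) (m : J →₀ ℕ) (j : J) :
    ((Finsupp.mapDomain π)^[n] m) ((π ^ n) j) = m j := by
  induction n with
  | zero => rfl
  | succ n ih =>
    rw [Function.iterate_succ_apply', pow_succ', Equiv.Perm.mul_apply,
      Finsupp.mapDomain_apply π.injective, ih]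

/-- If all orbits of the variables are infinite, then so are the orbits of the monomials other
than `1`. -/
lemma mapDomain_iterate_ne {π : Equiv.Perm J} (hinf : ∀ j n, 0 < n → (π ^ n) j ≠ j) {n : ℕ}
    (hn : 0 < n) {m : J →₀ ℕ} (hm : (Finsupp.mapDomain π)^[n] m = m) : m = 0 := by
  by_contra hne
  obtain ⟨j, hj⟩ := Finsupp.ne_iff.1 hne
  have hstab : ∀ i, m ((π ^ n) i) = m i := fun i => by
    have := mapDomain_iterate_apply π n m i
    rwa [hm] at this
  obtain ⟨k, hk, hkj⟩ := exists_iterate_eq_of_mapsTo (π ^ n).injective m.support.finite_toSet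
    (fun i hi => by simpa [hstab] using hi) (x := j) (by simpa using hj)
  refine hinf j (n * k) (Nat.mul_pos hn hk) ?_
  rw [pow_mul]
  rwa [Equiv.Perm.iterate_eq_pow] at hkj

/-- If all orbits of the variables are infinite, then so are the orbits of the primes. -/
lemma primePerm_polyAut_pow_ne {K : Type*} [Field K] (σ : K ≃+* K) {π : Equiv.Perm J}
    (hinf : ∀ j n, 0 < n → (π ^ n) j ≠ j)
    (p : {p : Associates (MvPolynomial J K) // Prime p}) {n : ℕ} (hn : 0 < n) :
    (primePerm (associatesEquiv (polyAut σ π).toMulEquiv) ^ n) p ≠ p := by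
  classical
  intro hfix
  obtain ⟨p, hp⟩ := p
  obtain ⟨q, rfl⟩ := Associates.mk_surjective p
  have hfix' := congrArg Subtype.val hfix
  rw [primePerm_pow_coe, associatesEquiv_iterate_mk, Associates.mk_eq_mk_iff_associated] at hfix'
  obtain ⟨u, hu⟩ := hfix'
  obtain ⟨r, hr, hur⟩ := isUnit_iff_eq_C_of_isReduced.1 u.isUnit
  rw [hur] at hu
  change (polyAut σ π)^[n] q * C r = q at hu
  -- The associating unit is a nonzero constant, so it does not change which monomials occur.
  have hsupp : ∀ m, coeff ((Finsupp.mapDomain π)^[n] m) q ≠ 0 ↔ coeff m q ≠ 0 := fun m => by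
    rw [← coeff_polyAut_iterate σ π n q m]
    conv_lhs => rw [← hu, mul_comm, coeff_C_mul]
    simp [hr.ne_zero]
  have hconst : ∀ m, coeff m q ≠ 0 → m = 0 := fun m hm => by
    obtain ⟨k, hk, hkm⟩ := exists_iterate_eq_of_mapsTo
      ((Finsupp.mapDomain_injective π.injective).iterate n) q.support.finite_toSet
      (fun m hm => by
        rw [Finset.mem_coe, mem_support_iff] at hm ⊢
        exact (hsupp m).2 hm) (x := m) (by simpa using hm)
    rw [← Function.iterate_mul] at hkm
    exact mapDomain_iterate_ne hinf (Nat.mul_pos hn hk) hkm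
  have hq : Prime q := Associates.prime_mk.1 hp
  obtain ⟨m, hm⟩ := ne_zero_iff.1 hq.ne_zero
  have hqC : q = C (coeff 0 q) := by
    ext m
    rw [coeff_C]
    split_ifs with h0
    · rw [h0]
    · by_contra hne
      exact h0 (hconst m hne).symm
  refine hq.not_isUnit ?_
  rw [hqC, isUnit_iff_eq_C_of_isReduced]
  refine ⟨_, IsUnit.mk0 _ ?_, rfl⟩
  rwa [hconst m hm] at hm

end PolyAut

/-! ### Combining both families of primes, and the theorem -/

lemma sumCongr_pow_ne {I I' : Type*} {π : Equiv.Perm I} {π' : Equiv.Perm I'}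
    (h : ∀ i n, 0 < n → (π ^ n) i ≠ i) (h' : ∀ i n, 0 < n → (π' ^ n) i ≠ i) (i : I ⊕ I') (n : ℕ)
    (hn : 0 < n) : (Equiv.Perm.sumCongr π π' ^ n) i ≠ i := by
  have key : Equiv.Perm.sumCongr π π' ^ n = Equiv.Perm.sumCongr (π ^ n) (π' ^ n) :=
    (map_pow (Equiv.Perm.sumCongrHom I I') (π, π') n).symm
  rw [key]
  rcases i with i | i
  · simpa using h i n hn
  · simpa using h' i n hn

end KrullVSimple

theorem mainTheorem4 {D : Type*} [CommRing D] {H : Type*} [CommMonoid H]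
    (hD : KrullVSimple.IsKrullDomain D) (hH : KrullVSimple.IsKrullMonoid H)
    (hred : KrullVSimple.IsReducedMonoid H)
    (σ : D ≃+* D) (hσ : KrullVSimple.IsVSimpleRing σ)
    (τ : H ≃* H) (hτ : KrullVSimple.IsVSimple τ)
    (φ : MonoidAlgebra D H ≃+* MonoidAlgebra D H)
    (hφσ : ∀ d : D, φ (MonoidAlgebra.single 1 d) = MonoidAlgebra.single 1 (σ d))
    (hφτ : ∀ h : H, φ (MonoidAlgebra.single h 1) = MonoidAlgebra.single (τ h) 1) :
    KrullVSimple.IsKrullDomain (MonoidAlgebra D H) ∧ KrullVSimple.IsVSimpleRing φ := by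
  open KrullVSimple in
  have := hD.isDomain
  have := hH.cancel
  obtain ⟨I, δ, hδ, hδσ⟩ := hD.exists_isValuativeDivisorMap
  obtain ⟨J, ε, hε, -, hετ⟩ := hH.exists_isDivisorMap
  obtain ⟨ρ, hρ, hρinf⟩ := hδσ σ hσ
  obtain ⟨π, hπ, hπinf⟩ := hετ τ hτ
  have hinj := hε.injective_of_isReducedMonoid hred
  let ι := hε.toMvPolynomial D
  have hι : Function.Injective ι := hε.toMvPolynomial_injective hinj
  have hι0 : ∀ {f}, f ≠ 0 → ι f ≠ 0 := fun hf => (map_ne_zero_iff _ hι).2 hf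
  have : IsDomain (MonoidAlgebra D H) := hι.isDomain ι.toRingHom
  let K := FractionRing D
  have hpoly := hδ.isRingDivisorMap_polyDivisor (J := J) K
  have hmain : IsRingDivisorMap fun f => polyDivisor K δ (ι f) :=
    ⟨fun ha hb => by rw [map_mul, hpoly.map_mul (hι0 ha) (hι0 hb)], fun ha hb => by
      rw [← hpoly.dvd_iff (hι0 ha) (hι0 hb), hε.toMvPolynomial_dvd_iff hinj ha]⟩
  let σK : K ≃+* K := IsFractionRing.ringEquivOfRingEquiv σ
  -- Two ring homomorphisms on the monoid algebra agree once they agree on `D` and on `H`.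
  have hφ : ∀ f, ι (φ f) = polyAut σ π (ι f) := by
    have : (ι.toRingHom.comp φ.toRingHom) = (polyAut σ π).toRingHom.comp ι.toRingHom := by
      refine MonoidAlgebra.ringHom_ext (fun d => ?_) fun h => ?_
      · change ι (φ _) = polyAut σ π (ι _)
        rw [hφσ, hε.toMvPolynomial_single, hε.toMvPolynomial_single, polyAut_monomial]
        have h1 : ε 1 = 0 := by simpa using hε.map_mul 1 1
        rw [h1, Finsupp.mapDomain_zero]
      · change ι (φ _) = polyAut σ π (ι _)
        rw [hφτ, hε.toMvPolynomial_single, hε.toMvPolynomial_single, polyAut_monomial,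
          map_one σ]
        have hετh : ε (τ h) = (ε h).mapDomain π := by
          refine Finsupp.ext fun j => ?_
          obtain ⟨j, rfl⟩ := π.surjective j
          rw [hπ, Finsupp.mapDomain_apply π.injective]
        rw [hετh]
    exact fun f => DFunLike.congr_fun this f
  refine ⟨hmain.isKrullDomain, hmain.isVSimpleRing φ
    (Equiv.Perm.sumCongr ρ (primePerm (associatesEquiv (polyAut σK π).toMulEquiv)))
    (fun f hf i => ?_) (sumCongr_pow_ne hρinf fun p n hn => primePerm_polyAut_pow_ne σK hπinf p hn)⟩
  simp only [hφ, polyDivisor]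
  rcases i with i | p
  · exact content_polyAut σ π ρ hρ (hι0 hf) i
  · have hmap : MvPolynomial.map (algebraMap D K) (polyAut σ π (ι f)) =
        polyAut σK π (MvPolynomial.map (algebraMap D K) (ι f)) :=
      map_polyAut _ σ σK (fun a => (IsFractionRing.ringEquivOfRingEquiv_algebraMap σ a).symm) π _
    rw [hmap, Equiv.Perm.sumCongr_apply, Sum.map_inr, Finsupp.sumElim_inr, Finsupp.sumElim_inr]
    exact primeExponents_map (associatesEquiv (polyAut σK π).toMulEquiv)
      (map_algebraMap_ne_zero K (hι0 hf)) p
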